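/- Let $(T,\le)$ be a tree: a partially ordered set such that $\{s\in T : s<t\}$ is well ordered for each $t\in T$, which is rooted (has a unique minimal element $0$) and chain complete (every chain has a supremum). For $t\in T$ let $V_t=\{s\in T: s\ge t\}$, $\widehat t=\{s\in T: s\le t\}$, let $\mathrm{ht}(t)$ be the order type of $\{s: s<t\}$, let $\mathrm{cf}(t)$ be the cofinality of $\mathrm{ht}(t)$, and let $\mathrm{ims}(t)$ be the set of immediate successors of $t$. Put $I(T)=\{t:\mathrm{ht}(t)\text{ is }0\text{ or a successor ordinal}\}$ and $S(T)=\{t:\mathrm{cf}(t)\le\aleph_0\}$. Equip $T$ with the (compact Hausdorff) coarse wedge topology, whose subbasis consists of the sets $V_t$ and $T\setminus V_t$, $t\in I(T)$. Let $C(T)$ be the Banach space of (real- or complex-valued) continuous functions on $T$ with the supremum norm. For $x\in I(T)$ let $g_x=\chi_{V_x}\in C(T)$; let $\nu_0=\delta_0$ and, for $x\in I(T)\setminus\{0\}$, let $\nu_x=\delta_x-\delta_{x^-}$, where $x^-$ is the immediate predecessor of $x$. (a) $(g_x,\nu_x)_{x\in I(T)}$ is a strong Markushevich basis of $C(T)$.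 That is: $\nu_x(g_x)=1$ and $\nu_x(g_y)=0$ for $x\ne y$; the closed linear span of $\{g_x : x\in I(T)\}$ is $C(T)$; the functionals $\nu_x$ separate the points of $C(T)$; and each $f\in C(T)$ belongs to the closed linear span of $\{g_x: x\in I(T),\ \nu_x(f)\ne 0\}$. (b) Assume that $T$ is an $r_1$-tree, i.e. $\mathrm{ims}(x)$ has at most one point whenever $\mathrm{cf}(x)$ is uncountable. Let $H=\{g_x : x\in I(T)\}\cup\{0\}$, let $D(T)$ be the space of (real or complex) Radon measures on $T$ whose support is contained in $S(T)$, and let $\sigma=\sigma(C(T),D(T))$ be the coarsest topology on $C(T)$ making $f\mapsto\int f\,d\mu$ continuous for each $\mu\in D(T)$. Let $\mathcal A_\omega$ be the family of all closed separable sets $A\subset T$ containing $0$ such that $r_A(t)=\max(A\cap\widehat t)$ defines a continuous retraction of $T$ onto $A$ and such that $\max(\widehat x\cap\widehat y)\in A$ whenever $x,y\in A$. For $A\in\mathcal A_\omega$ put $P_Af=f\circ r_A$, $f\in C(T)$. Then: (i) $H$ is $\sigma$-closed, and $P_A(H)\subset H$ for each $A\in\mathcal A_\omega$. (ii) The nonzero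 $\sigma$-accumulation points of $H$ are exactly the functions $g_x$ with $x\in I(T)\setminus\{0\}$ and $\mathrm{cf}(x^-)$ uncountable. (iii) $0$ is a $\sigma$-accumulation point of $H$ if and only if the set of all maximal elements of $T$ is infinite or contains an element on a limit level of uncountable cofinality. -/

import Mathlib

open Set Topology

namespace WedgeTree

universe u v

/-! ### Trees -/

/-- A rooted chain-complete tree.  The root is the least element `⊥` (every strict initial segment
being well ordered, a least element is the same thing as a unique minimal element). -/
class ChainCompleteTree (T : Type u) [PartialOrder T] [OrderBot T] : Prop where
  isWellOrder_Iio : ∀ t : T, IsWellOrder (Iio t) (· < ·)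
  exists_isLUB : ∀ C : Set T, IsChain (· ≤ ·) C → ∃ x, IsLUB C x

section Order

variable {T : Type u} [PartialOrder T] [OrderBot T]

open Classical in
/-- The greatest element of a set (with value `⊥` if there is none). -/
noncomputable def maxElt (s : Set T) : T :=
  if h : ∃ m, IsGreatest s m then h.choose else ⊥

theorem isGreatest_maxElt {s : Set T} (h : ∃ m, IsGreatest s m) : IsGreatest s (maxElt s) := by
  unfold maxElt
  rw [dif_pos h]
  exact h.choose_spec

/-- `r_A(t) = max (A ∩ {s | s ≤ t})`. -/
noncomputable def retr (A : Set T) (t : T) : T := maxElt (A ∩ Iic t)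

/-- `s ∧ t = max ({u | u ≤ s} ∩ {u | u ≤ t})`. -/
noncomputable def wedge (s t : T) : T := maxElt (Iic s ∩ Iic t)

/-- `x⁻`, the immediate predecessor of `x` (used only for `x ≠ ⊥` on an isolated level). -/
noncomputable def predecessor (x : T) : T := maxElt (Iio x)

/-- The set of immediate successors of `t`. -/
def ims (t : T) : Set T := {s | t ⋖ s}

variable [ChainCompleteTree T]

/-- `ht(t, T)`, the order type of `{s | s < t}`. -/
noncomputable def height (t : T) : Ordinal.{u} :=
  @Ordinal.type (Iio t) (· < ·) (ChainCompleteTree.isWellOrder_Iio t)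

/-- The cofinality of `t`, i.e. that of the ordinal `ht(t, T)`. -/
noncomputable def cofinality (t : T) : Cardinal.{u} := (height t).cof

variable (T) in
/-- `I(T)`: the elements whose height is an isolated (that is, zero or successor) ordinal. -/
def isolatedPart : Set T := {t | ¬ Order.IsSuccLimit (height t)}

variable (T) in
/-- `S(T)`: the elements of at most countable cofinality. -/
def countablePart : Set T := {t | cofinality t ≤ Cardinal.aleph0}

variable (T) in
/-- An `r₁`-tree: each element of uncountable cofinality has at most one immediate successor. -/
def IsROneTree : Prop := ∀ x : T, Cardinal.aleph0 < cofinality x → (ims x).Subsingleton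

theorem le_total_of_le {a b t : T} (ha : a ≤ t) (hb : b ≤ t) : a ≤ b ∨ b ≤ a := by
  rcases ha.eq_or_lt with rfl | ha
  · exact Or.inr hb
  rcases hb.eq_or_lt with rfl | hb
  · exact Or.inl ha.le
  have := ChainCompleteTree.isWellOrder_Iio t
  rcases trichotomous_of (· < ·) (⟨a, ha⟩ : Iio t) ⟨b, hb⟩ with h | h | h
  · exact Or.inl (le_of_lt h)
  · exact Or.inl (le_of_eq (congrArg Subtype.val h))
  · exact Or.inr (le_of_lt h)

theorem mem_isolatedPart_iff {t : T} :
    t ∈ isolatedPart T ↔ t = ⊥ ∨ ∃ p, IsGreatest (Iio t) p := by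
  classical
  have hw := ChainCompleteTree.isWellOrder_Iio t
  let _ : LinearOrder (Iio t) :=
    { (inferInstance : PartialOrder (Iio t)) with
      le_total := fun a b => le_total_of_le (T := T) (a := a.1) (b := b.1) a.2.le b.2.le
      toDecidableLE := Classical.decRel _ }
  have : WellFoundedLT (Iio t) := ⟨hw.wf⟩
  have h1 : height t = 0 ↔ t = ⊥ := by
    unfold height
    rw [Ordinal.type_eq_zero_iff_isEmpty, isEmpty_subtype]
    constructor
    · intro h
      by_contra hne
      exact h ⊥ (bot_lt_iff_ne_bot.2 hne)
    · rintro rfl x hx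
      exact not_lt_bot hx
  have h2 : Order.IsSuccPrelimit (height t) ↔ NoMaxOrder (Iio t) :=
    Ordinal.isSuccPrelimit_type_lt_iff (α := Iio t)
  have h3 : NoMaxOrder (Iio t) ↔ ¬ ∃ p, IsGreatest (Iio t) p := by
    constructor
    · rintro h ⟨p, hp, hp'⟩
      obtain ⟨q, hq⟩ := h.exists_gt ⟨p, hp⟩
      exact absurd (lt_of_lt_of_le (show p < q.1 from hq) (hp' q.2)) (lt_irrefl _)
    · intro h
      refine ⟨fun a => ?_⟩
      by_contra hne
      push Not at hne
      exact h ⟨a.1, a.2, fun b hb => hne ⟨b, hb⟩⟩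
  change ¬ Order.IsSuccLimit (height t) ↔ _
  rw [Ordinal.isSuccLimit_iff, ← h1, h2, h3]
  tauto

/-- The maximum in the definition of `s ∧ t` is attained, so no default value is involved. -/
theorem isGreatest_wedge (s t : T) : IsGreatest (Iic s ∩ Iic t) (wedge s t) := by
  apply isGreatest_maxElt
  obtain ⟨x, hx⟩ := ChainCompleteTree.exists_isLUB (Iic s ∩ Iic t)
    (fun a ha b hb _ => le_total_of_le ha.1 hb.1)
  exact ⟨x, ⟨hx.2 fun a ha => ha.1, hx.2 fun a ha => ha.2⟩, hx.1⟩

theorem isGreatest_predecessor {x : T} (hx : x ∈ isolatedPart T) (h0 : x ≠ ⊥) :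
    IsGreatest (Iio x) (predecessor x) :=
  isGreatest_maxElt ((mem_isolatedPart_iff.1 hx).resolve_left h0)

end Order

/-! ### The coarse wedge topology -/

/-- The topology of `T` is the coarse wedge topology, with subbasis `V_t = {s | t ≤ s}` and
`T \ V_t`, for `t` on an isolated level. -/
class CoarseWedgeTopology (T : Type u) [PartialOrder T] [OrderBot T] [ChainCompleteTree T]
    [τ : TopologicalSpace T] : Prop where
  eq_generateFrom :
    τ = TopologicalSpace.generateFrom {U | ∃ t ∈ isolatedPart T, U = Ici t ∨ U = (Ici t)ᶜ}

section Space

variable {T : Type u} [PartialOrder T] [OrderBot T] [ChainCompleteTree T] [TopologicalSpace T]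
  [CoarseWedgeTopology T]

theorem isClopen_Ici {t : T} (ht : t ∈ isolatedPart T) : IsClopen (Ici t) := by
  have h := CoarseWedgeTopology.eq_generateFrom (T := T)
  constructor
  · rw [← isOpen_compl_iff, h]
    exact TopologicalSpace.isOpen_generateFrom_of_mem ⟨t, ht, Or.inr rfl⟩
  · rw [h]
    exact TopologicalSpace.isOpen_generateFrom_of_mem ⟨t, ht, Or.inl rfl⟩

/-- A tree with its coarse wedge topology is compact. -/
instance instCompactSpace : CompactSpace T := by
  refine compactSpace_generateFrom CoarseWedgeTopology.eq_generateFrom ?_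
  intro P hP hcov
  by_contra hno
  push Not at hno
  have key : ∀ U ∈ P, ∀ W ∈ P, U ∪ W ≠ univ := by
    intro U hU W hW h
    refine hno {U, W} ?_ (toFinite _) ?_
    · rintro x (rfl | rfl) <;> assumption
    · rw [sUnion_pair, h]
  set N : Set T := {t | (Ici t)ᶜ ∈ P} with hN
  have hchain : IsChain (· ≤ ·) N := by
    intro s hs t ht _
    by_contra hne
    push Not at hne
    refine key _ hs _ ht ?_
    rw [← compl_inter, compl_univ_iff]
    ext x
    simp only [mem_inter_iff, mem_Ici, mem_empty_iff_false, iff_false, not_and]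
    intro h1 h2
    rcases le_total_of_le h1 h2 with h | h
    · exact hne.1 h
    · exact hne.2 h
  obtain ⟨x, hx⟩ := ChainCompleteTree.exists_isLUB N hchain
  obtain ⟨U, hU, hxU⟩ : x ∈ ⋃₀ P := by rw [hcov]; trivial
  obtain ⟨p, hp, rfl | rfl⟩ := hP hU
  · have hlt : ∀ t ∈ N, t < p := by
      intro t ht
      rcases le_total_of_le (hx.1 ht) hxU with h | h
      · rcases h.eq_or_lt with rfl | h
        · exact absurd (union_compl_self _) (key _ hU _ ht)
        · exact h
      · refine absurd ?_ (key _ hU _ ht)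
        rw [eq_univ_iff_forall]
        intro y
        by_cases hy : t ≤ y
        · exact Or.inl (h.trans hy)
        · exact Or.inr hy
    have hxp : x = p := le_antisymm (hx.2 fun t ht => (hlt t ht).le) hxU
    rcases mem_isolatedPart_iff.1 hp with rfl | ⟨q, hq, hq'⟩
    · refine key _ hU _ hU ?_
      rw [union_self, eq_univ_iff_forall]
      exact fun y => bot_le
    · have : x ≤ q := hx.2 fun t ht => hq' (hlt t ht)
      rw [hxp] at this
      exact absurd (lt_of_lt_of_le hq this) (lt_irrefl _)
  · exact hxU (hx.1 hU)

/-- For a closed set `A` containing the root the maximum in the definition of `r_A` is attained. -/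
theorem isGreatest_retr {A : Set T} (hA : IsClosed A) (h0 : ⊥ ∈ A) (t : T) :
    IsGreatest (A ∩ Iic t) (retr A t) := by
  apply isGreatest_maxElt
  have hchain : IsChain (· ≤ ·) (A ∩ Iic t) := fun a ha b hb _ => le_total_of_le ha.2 hb.2
  obtain ⟨x, hx⟩ := ChainCompleteTree.exists_isLUB _ hchain
  have hxt : x ≤ t := hx.2 fun a ha => ha.2
  suffices hxA : x ∈ A from ⟨x, ⟨hxA, hxt⟩, hx.1⟩
  have : Nonempty (A ∩ Iic t : Set T) := ⟨⟨⊥, h0, bot_le⟩⟩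
  have : IsDirectedOrder (A ∩ Iic t : Set T) := by
    refine ⟨fun a b => ?_⟩
    rcases le_total_of_le a.2.2 b.2.2 with h | h
    · exact ⟨b, h, le_rfl⟩
    · exact ⟨a, le_rfl, h⟩
  by_contra hxA
  have hlt : ∀ a ∈ A ∩ Iic t, a < x :=
    fun a ha => lt_of_le_of_ne (hx.1 ha) (fun h => hxA (h ▸ ha.1))
  refine hxA (hA.mem_of_tendsto (b := Filter.atTop)
    (f := fun a : (A ∩ Iic t : Set T) => (a : T)) ?_ (Filter.Eventually.of_forall fun a => a.2.1))
  rw [CoarseWedgeTopology.eq_generateFrom (T := T), TopologicalSpace.tendsto_nhds_generateFrom_iff]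
  rintro U ⟨s, hs, rfl | rfl⟩ hxU
  · have hsx : s ≤ x := hxU
    obtain ⟨a, ha, hsa⟩ : ∃ a ∈ A ∩ Iic t, s ≤ a := by
      by_contra hne
      push Not at hne
      have has : ∀ a ∈ A ∩ Iic t, a < s := fun a ha =>
        lt_of_le_not_ge ((le_total_of_le hsx (hx.1 ha)).resolve_left (hne a ha)) (hne a ha)
      have hsx' : s = x := le_antisymm hsx (hx.2 fun a ha => (has a ha).le)
      rcases mem_isolatedPart_iff.1 hs with rfl | ⟨q, hq, hq'⟩
      · exact not_lt_bot (has ⊥ ⟨h0, bot_le⟩)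
      · have : x ≤ q := hx.2 fun a ha => hq' (has a ha)
        rw [← hsx'] at this
        exact absurd (lt_of_lt_of_le hq this) (lt_irrefl _)
    filter_upwards [Filter.eventually_ge_atTop (⟨a, ha⟩ : (A ∩ Iic t : Set T))] with b hb
    exact hsa.trans hb
  · exact Filter.Eventually.of_forall fun b hb => hxU (le_trans hb (hx.1 b.2))

variable (T) in
/-- `𝒜⁰(T)`: the closed sets `A ∋ 0` for which `r_A` is a continuous retraction of `T` onto `A`
(being the maximum of `A ∩ {s | s ≤ t}`, `r_A` always maps into `A` and fixes the points of `A`). -/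
def retractFamily : Set (Set T) := {A | IsClosed A ∧ ⊥ ∈ A ∧ Continuous (retr A)}

variable (T) in
/-- `𝒜(T)`: the elements of `𝒜⁰(T)` which are closed under `∧`. -/
def wedgeFamily : Set (Set T) := {A ∈ retractFamily T | ∀ x ∈ A, ∀ y ∈ A, wedge x y ∈ A}

variable (T) in
/-- `𝒜_ω(T)`: the separable elements of `𝒜(T)`. -/
def separableFamily : Set (Set T) := {A ∈ wedgeFamily T | TopologicalSpace.SeparableSpace A}

variable {𝕜 : Type v} [RCLike 𝕜]

/-- The projection `P_A f = f ∘ r_A` on `C(T)`. -/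
noncomputable def proj (A : Set T) (hA : A ∈ retractFamily T) (f : C(T, 𝕜)) : C(T, 𝕜) :=
  f.comp ⟨retr A, hA.2.2⟩

variable (𝕜) in
/-- `g_x`, the characteristic function of `V_x`. -/
noncomputable def basisFun (x : isolatedPart T) : C(T, 𝕜) :=
  ⟨(Ici (x : T)).indicator 1, (isClopen_Ici x.2).continuous_indicator continuous_one⟩

open Classical in
variable (𝕜) in
/-- `ν_x`: the functional `δ_0` if `x` is the root, and `δ_x - δ_{x⁻}` otherwise. -/
noncomputable def basisFunctional (x : isolatedPart T) : StrongDual 𝕜 C(T, 𝕜) :=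
  if (x : T) = ⊥ then ContinuousMap.evalCLM 𝕜 (⊥ : T)
  else ContinuousMap.evalCLM 𝕜 (x : T) - ContinuousMap.evalCLM 𝕜 (predecessor (x : T))

variable (T 𝕜) in
/-- `H = {g_x | x ∈ I(T)} ∪ {0}`. -/
def basisSet : Set C(T, 𝕜) := range (basisFun (T := T) 𝕜) ∪ {0}

end Space

/-! ### Markushevich bases -/

section Basis

variable {𝕜 : Type v} [RCLike 𝕜] {X : Type u} [NormedAddCommGroup X] [NormedSpace 𝕜 X]

/-- `(x_a, φ_a)` is a Markushevich basis of `X`. -/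
structure IsMarkushevichBasis {Λ : Type*} (x : Λ → X) (φ : Λ → StrongDual 𝕜 X) : Prop where
  apply_self : ∀ a, φ a (x a) = 1
  apply_of_ne : ∀ a b, a ≠ b → φ a (x b) = 0
  closure_span : closure (Submodule.span 𝕜 (range x) : Set X) = univ
  separates : ∀ y z : X, y ≠ z → ∃ a, φ a y ≠ φ a z

/-- `(x_a, φ_a)` is a strong Markushevich basis of `X`. -/
structure IsStrongMarkushevichBasis {Λ : Type*} (x : Λ → X) (φ : Λ → StrongDual 𝕜 X) : Prop
    extends IsMarkushevichBasis x φ where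
  mem_closure_span : ∀ y : X, y ∈ closure (Submodule.span 𝕜 (x '' {a | φ a y ≠ 0}) : Set X)

end Basis

/-! ### Radon measures and the topology `σ(C(T), D(T))` -/

section Measure

variable {K : Type u} [TopologicalSpace K] [MeasurableSpace K] {𝕜 : Type v} [RCLike 𝕜]

/-- A scalar Borel measure is Radon if its total variation is a finite regular measure. -/
def IsRadon (μ : MeasureTheory.VectorMeasure K 𝕜) : Prop :=
  MeasureTheory.IsFiniteMeasure μ.variation ∧ μ.variation.Regular

/-- The pairing `∫ f dμ`. -/
noncomputable def pairing (f : C(K, 𝕜)) (μ : MeasureTheory.VectorMeasure K 𝕜) : 𝕜 :=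
  μ.integral f (ContinuousLinearMap.mul ℝ 𝕜)

/-- `σ(C(K), D)`: the coarsest topology on `C(K)` making `f ↦ ∫ f dμ` continuous for `μ ∈ D`. -/
noncomputable abbrev sigmaTopology (D : Set (MeasureTheory.VectorMeasure K 𝕜)) :
    TopologicalSpace C(K, 𝕜) :=
  ⨅ μ ∈ D, TopologicalSpace.induced (fun f => pairing f μ) inferInstance

end Measure

/-- `D(T)`: the Radon measures on `T` whose support is contained in `S(T)`. -/
def measureSpaceD (T : Type u) [PartialOrder T] [OrderBot T] [ChainCompleteTree T]
    [TopologicalSpace T] [MeasurableSpace T] (𝕜 : Type v) [RCLike 𝕜] :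
    Set (MeasureTheory.VectorMeasure T 𝕜) :=
  {μ | IsRadon μ ∧ μ.variation.support ⊆ countablePart T}

end WedgeTree

open WedgeTree

namespace WedgeTree

universe u v

/-! ### Order structure: least elements, immediate successors, isolated elements. -/

section Order

variable {T : Type u} [PartialOrder T] [OrderBot T] [ChainCompleteTree T]

/-! Part (a). Two sets `V_x`, `V_y` are nested or disjoint, so a span of functions `g_x` containing
the constants is a star algebra. By Stone–Weierstrass its closure contains every `f` that is
constant on the classes of points it cannot separate. Induction along a branch shows that `f s = f
w` if `ν_x f = 0` for all isolated `x` in `(w, s]` (`apply_eq_of_basisFunctional_eq_zero`). If no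
`g_x` with `ν_x f ≠ 0` separates `s` from `t`, no such `x` lies strictly above `s ∧ t` on either
branch, whence `f s = f (s ∧ t) = f t`. The strong property follows, and with it density and
separation.

Part (b). Dirac measures make evaluations at points of `S(T)` σ-continuous, and functions in `H`
take only the values 0 and 1. A function in the σ-closure therefore agrees with a member of `H` at
any three points of `S(T)`; this gives closedness of `H`, and similar evaluations give the negative
halves of (ii) and (iii). For accumulation, let isolated `y` increase to `w`: by compactness `V_y`
shrinks to `V_w` (`eventually_branchFilter_Ici_subset`). If `w` has uncountable cofinality, each `μ
∈ D(T)` misses `w`, so the integrals of `g_y` are eventually those of the characteristic function of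
`V_w \ {w}`: this is `V_x` for an `r₁`-tree with `w = x⁻`, and empty for maximal `w`. Infinitely
many maximal elements also lead to 0, since a finite measure has only small mass at all but finitely
many of them. -/

theorem exists_isLeast_of_subset_Iic {s : Set T} {t : T} (hs : s.Nonempty) (hst : s ⊆ Iic t) :
    ∃ m, IsLeast s m := by
  by_cases hne : ∃ a ∈ s, a < t
  · obtain ⟨a, has, hat⟩ := hne
    obtain ⟨m, hm, hmin⟩ := (ChainCompleteTree.isWellOrder_Iio t).wf.has_min
      {x : Iio t | (x : T) ∈ s} ⟨⟨a, hat⟩, has⟩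
    refine ⟨m, hm, fun b hb => ?_⟩
    rcases (hst hb).eq_or_lt with rfl | hbt
    · exact m.2.le
    · rcases le_total_of_le m.2.le hbt.le with h | h
      · exact h
      · rcases h.eq_or_lt with h | h
        · exact h.ge
        · exact absurd h (hmin ⟨b, hbt⟩ hb)
  · push Not at hne
    have key : ∀ a ∈ s, a = t := fun a ha => (hst ha).eq_or_lt.resolve_right (hne a ha)
    obtain ⟨a, ha⟩ := hs
    exact ⟨a, ha, fun b hb => by rw [key a ha, key b hb]⟩

theorem exists_covBy_le {w x : T} (h : w < x) : ∃ s, w ⋖ s ∧ s ≤ x := by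
  obtain ⟨s, hs, hmin⟩ := exists_isLeast_of_subset_Iic (s := Ioc w x) (t := x)
    ⟨x, h, le_rfl⟩ fun a ha => ha.2
  exact ⟨s, ⟨hs.1, fun c hwc hcs => (hmin ⟨hwc, hcs.le.trans hs.2⟩).not_gt hcs⟩, hs.2⟩

theorem isGreatest_Iio_of_covBy {w s : T} (h : w ⋖ s) : IsGreatest (Iio s) w := by
  refine ⟨h.1, fun b hb => ?_⟩
  rcases le_total_of_le (le_of_lt hb) h.1.le with h' | h'
  · exact h'
  · rcases h'.eq_or_lt with h' | h'
    · exact h'.ge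
    · exact absurd hb (h.2 h')

theorem mem_isolatedPart_of_covBy {w s : T} (h : w ⋖ s) : s ∈ isolatedPart T :=
  mem_isolatedPart_iff.2 (Or.inr ⟨w, isGreatest_Iio_of_covBy h⟩)

theorem bot_mem_isolatedPart : (⊥ : T) ∈ isolatedPart T :=
  mem_isolatedPart_iff.2 (Or.inl rfl)

theorem predecessor_covBy {x : T} (hx : x ∈ isolatedPart T) (h0 : x ≠ ⊥) :
    predecessor x ⋖ x :=
  have h := isGreatest_predecessor hx h0
  ⟨h.1, fun _ hc hcx => (h.2 hcx).not_gt hc⟩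

theorem le_predecessor_iff {x y : T} (hx : x ∈ isolatedPart T) (h0 : x ≠ ⊥) :
    y ≤ predecessor x ↔ y < x :=
  have h := isGreatest_predecessor hx h0
  ⟨fun hy => hy.trans_lt h.1, fun hy => h.2 hy⟩

/-- Otherwise the immediate successor of `w ∧ z` towards `w` is isolated, hence also below `z`,
against the maximality of the meet. So the subbasic sets detect the order, which makes the topology
Hausdorff. -/
theorem le_of_forall_isolatedPart {w z : T} (h : ∀ y ∈ isolatedPart T, y ≤ w → y ≤ z) :
    w ≤ z := by
  have hg := isGreatest_wedge w z
  by_contra hwz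
  have hlt : wedge w z < w := lt_of_le_of_ne hg.1.1 fun he => hwz (he ▸ hg.1.2)
  obtain ⟨s, hs, hsw⟩ := exists_covBy_le hlt
  exact (hg.2 ⟨hsw, h s (mem_isolatedPart_of_covBy hs) hsw⟩).not_gt hs.1

theorem isSuccLimit_height_of_aleph0_lt {t : T} (h : Cardinal.aleph0 < cofinality t) :
    Order.IsSuccLimit (height t) :=
  Ordinal.one_lt_cof_iff.1 (Cardinal.one_lt_aleph0.trans h)

theorem isolatedPart_subset_countablePart : isolatedPart T ⊆ countablePart T := fun t ht => by
  by_contra h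
  exact ht (isSuccLimit_height_of_aleph0_lt (not_le.1 h))

theorem exists_isMax_ge (t : T) : ∃ m, t ≤ m ∧ IsMax m := by
  obtain ⟨m, htm, hm⟩ := zorn_le_nonempty_Ici₀ t (fun c _ hc y _ => by
    obtain ⟨x, hx⟩ := ChainCompleteTree.exists_isLUB c hc
    exact ⟨x, hx.1⟩) t le_rfl
  exact ⟨m, htm, hm⟩

end Order

/-! ### Convergence along branches and the functions `g_x`. -/

section Space

variable {T : Type u} [PartialOrder T] [OrderBot T] [ChainCompleteTree T]

/-- The filter of the isolated elements that increase to `w`. -/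
def branchFilter (w : T) : Filter (isolatedPart T) :=
  Filter.map (fun y : {y : isolatedPart T // (y : T) ≤ w} => y.1) Filter.atTop

instance nonempty_isolated_le (w : T) : Nonempty {y : isolatedPart T // (y : T) ≤ w} :=
  ⟨⟨⟨⊥, bot_mem_isolatedPart⟩, bot_le⟩⟩

instance isDirectedOrder_isolated_le (w : T) :
    IsDirectedOrder {y : isolatedPart T // (y : T) ≤ w} := by
  refine ⟨fun a b => ?_⟩
  rcases le_total_of_le a.2 b.2 with h | h
  · exact ⟨b, h, le_rfl⟩
  · exact ⟨a, le_rfl, h⟩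

instance neBot_branchFilter (w : T) : (branchFilter w).NeBot :=
  inferInstanceAs (Filter.map _ _).NeBot

theorem eventually_branchFilter_le (w : T) : ∀ᶠ y : isolatedPart T in branchFilter w, (y : T) ≤ w :=
  Filter.eventually_map.2 (Filter.Eventually.of_forall fun y => y.2)

theorem eventually_branchFilter_ge {w z : T} (hz : z ∈ isolatedPart T) (hzw : z ≤ w) :
    ∀ᶠ y : isolatedPart T in branchFilter w, z ≤ (y : T) :=
  Filter.eventually_map.2 ((Filter.eventually_ge_atTop
    (⟨⟨z, hz⟩, hzw⟩ : {y : isolatedPart T // (y : T) ≤ w})).mono fun _ hy => hy)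

theorem basisFunctional_of_eq_bot [TopologicalSpace T] {𝕜 : Type v} [RCLike 𝕜]
    {x : isolatedPart T} (h : (x : T) = ⊥) (f : C(T, 𝕜)) :
    basisFunctional 𝕜 x f = f ⊥ := by
  simp [basisFunctional, h]

theorem basisFunctional_of_ne_bot [TopologicalSpace T] {𝕜 : Type v} [RCLike 𝕜]
    {x : isolatedPart T} (h : (x : T) ≠ ⊥) (f : C(T, 𝕜)) :
    basisFunctional 𝕜 x f = f x - f (predecessor (x : T)) := by
  simp [basisFunctional, h]

variable [TopologicalSpace T] [CoarseWedgeTopology T]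

instance instT2Space : T2Space T := by
  have key : ∀ x y : T, ¬ x ≤ y → ∃ u v : Set T, IsOpen u ∧ IsOpen v ∧ x ∈ u ∧ y ∈ v ∧
      Disjoint u v := by
    intro x y hxy
    obtain ⟨z, hz, hzx, hzy⟩ : ∃ z ∈ isolatedPart T, z ≤ x ∧ ¬ z ≤ y := by
      by_contra hne
      push Not at hne
      exact hxy (le_of_forall_isolatedPart hne)
    exact ⟨Ici z, (Ici z)ᶜ, (isClopen_Ici hz).2, (isClopen_Ici hz).compl.2, hzx, hzy,
      disjoint_compl_right⟩
  refine ⟨fun x y hxy => ?_⟩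
  by_cases h : x ≤ y
  · obtain ⟨u, v, hu, hv, hy, hx, hd⟩ := key y x fun h' => hxy (le_antisymm h h')
    exact ⟨v, u, hv, hu, hx, hy, hd.symm⟩
  · exact key x y h

theorem tendsto_branchFilter (w : T) : Filter.Tendsto (fun y : isolatedPart T => (y : T))
    (branchFilter w) (𝓝 w) := by
  rw [CoarseWedgeTopology.eq_generateFrom (T := T), TopologicalSpace.tendsto_nhds_generateFrom_iff]
  rintro U ⟨s, hs, rfl | rfl⟩ hwU
  · exact eventually_branchFilter_ge hs hwU
  · filter_upwards [eventually_branchFilter_le w] with y hy hsy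
    exact hwU (le_trans hsy hy)

/-- The closed sets `V_y`, for isolated `y ≤ w`, form a decreasing chain with intersection `V_w`;
compactness puts one of them inside `U`. -/
theorem eventually_branchFilter_Ici_subset {w : T} {U : Set T} (hU : IsOpen U)
    (hwU : Ici w ⊆ U) : ∀ᶠ y : isolatedPart T in branchFilter w, Ici (y : T) ⊆ U := by
  obtain ⟨y, hy⟩ := exists_subset_nhds_of_compactSpace
    (V := fun y : {y : isolatedPart T // (y : T) ≤ w} => Ici (y.1 : T)) (U := U)
    (directed_of_isDirected_le fun a b hab => Ici_subset_Ici.2 hab)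
    (fun y => (isClopen_Ici y.1.2).1)
    (fun x hx => hU.mem_nhds (hwU (le_of_forall_isolatedPart fun y hy hyw =>
      mem_iInter.1 hx ⟨⟨y, hy⟩, hyw⟩)))
  filter_upwards [eventually_branchFilter_ge y.1.2 y.2] with z hz
  exact (Ici_subset_Ici.2 hz).trans hy

/-- Isolated elements below `y` converge to `y`, so one of them enters the open set `V_y` and must
equal `y`. -/
theorem mem_isolatedPart_of_isOpen_Ici {y : T} (h : IsOpen (Ici y)) : y ∈ isolatedPart T := by
  obtain ⟨z, hz⟩ := ((eventually_branchFilter_le y).and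
    ((tendsto_branchFilter y).eventually (h.mem_nhds le_rfl))).exists
  exact le_antisymm hz.1 hz.2 ▸ z.2

variable {𝕜 : Type v} [RCLike 𝕜]

theorem basisFun_apply_of_le {x : isolatedPart T} {t : T} (h : (x : T) ≤ t) :
    basisFun 𝕜 x t = 1 :=
  indicator_of_mem (s := Ici (x : T)) (f := (1 : T → 𝕜)) h

theorem basisFun_apply_of_not_le {x : isolatedPart T} {t : T} (h : ¬ (x : T) ≤ t) :
    basisFun 𝕜 x t = 0 :=
  indicator_of_notMem (s := Ici (x : T)) (f := (1 : T → 𝕜)) h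

theorem basisFun_apply_eq_one_iff {x : isolatedPart T} {t : T} :
    basisFun 𝕜 x t = 1 ↔ (x : T) ≤ t := by
  refine ⟨fun h => ?_, basisFun_apply_of_le⟩
  by_contra hne
  rw [basisFun_apply_of_not_le hne] at h
  exact zero_ne_one h

theorem basisFun_apply_eq_zero_iff {x : isolatedPart T} {t : T} :
    basisFun 𝕜 x t = 0 ↔ ¬ (x : T) ≤ t := by
  refine ⟨fun h hle => ?_, basisFun_apply_of_not_le⟩
  rw [basisFun_apply_of_le hle] at h
  exact one_ne_zero h

theorem basisFun_apply_congr {x y : isolatedPart T} {s t : T} (h : (x : T) ≤ s ↔ (y : T) ≤ t) :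
    basisFun 𝕜 x s = basisFun 𝕜 y t := by
  by_cases hx : (x : T) ≤ s
  · rw [basisFun_apply_of_le hx, basisFun_apply_of_le (h.1 hx)]
  · rw [basisFun_apply_of_not_le hx, basisFun_apply_of_not_le (mt h.2 hx)]

theorem basisFun_injective : Function.Injective (basisFun (T := T) 𝕜) := by
  intro x y h
  have hx : basisFun 𝕜 y (x : T) = 1 := by rw [← h, basisFun_apply_of_le le_rfl]
  have hy : basisFun 𝕜 x (y : T) = 1 := by rw [h, basisFun_apply_of_le le_rfl]
  exact Subtype.ext (le_antisymm (basisFun_apply_eq_one_iff.1 hy)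
    (basisFun_apply_eq_one_iff.1 hx))

theorem basisFun_ne_zero (x : isolatedPart T) : basisFun 𝕜 x ≠ 0 := fun h =>
  one_ne_zero (α := 𝕜) <| by
    rw [← basisFun_apply_of_le (𝕜 := 𝕜) (x := x) le_rfl, h, ContinuousMap.zero_apply]

theorem basisFun_bot : basisFun (T := T) 𝕜 ⟨⊥, bot_mem_isolatedPart⟩ = 1 :=
  ContinuousMap.ext fun _ => basisFun_apply_of_le bot_le

theorem basisFun_mul_of_le {x y : isolatedPart T} (h : (x : T) ≤ y) :
    basisFun 𝕜 x * basisFun 𝕜 y = basisFun 𝕜 y := by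
  ext t
  rw [ContinuousMap.mul_apply]
  by_cases hy : (y : T) ≤ t
  · rw [basisFun_apply_of_le hy, basisFun_apply_of_le (h.trans hy), one_mul]
  · rw [basisFun_apply_of_not_le hy, mul_zero]

theorem basisFun_mul_of_incomparable {x y : isolatedPart T} (h : ¬ (x : T) ≤ y)
    (h' : ¬ (y : T) ≤ x) : basisFun 𝕜 x * basisFun 𝕜 y = 0 := by
  ext t
  rw [ContinuousMap.mul_apply, ContinuousMap.zero_apply]
  by_cases hx : (x : T) ≤ t
  · have hy : ¬ (y : T) ≤ t := fun hy => (le_total_of_le hx hy).elim h h'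
    rw [basisFun_apply_of_not_le hy, mul_zero]
  · rw [basisFun_apply_of_not_le hx, zero_mul]

theorem star_basisFun (x : isolatedPart T) : star (basisFun 𝕜 x) = basisFun 𝕜 x := by
  ext t
  rw [ContinuousMap.star_apply]
  by_cases hx : (x : T) ≤ t
  · rw [basisFun_apply_of_le hx, star_one]
  · rw [basisFun_apply_of_not_le hx, star_zero]

end Space

/-! ### The strong Markushevich basis. -/

section Basis

variable {T : Type u} [PartialOrder T] [OrderBot T] [ChainCompleteTree T] [TopologicalSpace T]
  [CoarseWedgeTopology T] {𝕜 : Type v} [RCLike 𝕜]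

/-- A least `u` in `[w, s]` with `f u ≠ f w` cannot exist: at an isolated level `ν_u f = 0` forbids
a jump from `u⁻`, and at a limit level continuity does. -/
theorem apply_eq_of_basisFunctional_eq_zero (f : C(T, 𝕜)) {w s : T} (hws : w ≤ s)
    (h : ∀ x : isolatedPart T, w < x → (x : T) ≤ s → basisFunctional 𝕜 x f = 0) :
    f s = f w := by
  by_contra hne
  obtain ⟨u, ⟨hwu, hus, hfu⟩, hmin⟩ := exists_isLeast_of_subset_Iic
    (s := {u | w ≤ u ∧ u ≤ s ∧ f u ≠ f w}) (t := s) ⟨s, hws, le_rfl, hne⟩ fun a ha => ha.2.1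
  have hwu : w < u := lt_of_le_of_ne hwu fun he => hfu (he ▸ rfl)
  have hlt : ∀ v, w ≤ v → v < u → f v = f w := fun v hwv hvu => by
    by_contra hv
    exact (hmin ⟨hwv, hvu.le.trans hus, hv⟩).not_gt hvu
  by_cases hu : u ∈ isolatedPart T
  · have hu0 : u ≠ ⊥ := ne_bot_of_gt hwu
    have h1 := h ⟨u, hu⟩ hwu hus
    rw [basisFunctional_of_ne_bot hu0, sub_eq_zero] at h1
    exact hfu (h1.trans (hlt _ ((le_predecessor_iff hu hu0).2 hwu)
      (predecessor_covBy hu hu0).1))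
  · obtain ⟨z, hz, hzu⟩ := exists_covBy_le hwu
    have h1 : Filter.Tendsto (fun y : isolatedPart T => f y) (branchFilter u) (𝓝 (f u)) :=
      (f.continuous.tendsto u).comp (tendsto_branchFilter u)
    have h2 : ∀ᶠ y : isolatedPart T in branchFilter u, f y = f w := by
      filter_upwards [eventually_branchFilter_ge (mem_isolatedPart_of_covBy hz) hzu,
        eventually_branchFilter_le u] with y hy hyu
      exact hlt y (hz.1.le.trans hy) (lt_of_le_of_ne hyu fun he => hu (he ▸ y.2))
    exact hfu (tendsto_nhds_unique h1 (tendsto_const_nhds.congr' (h2.mono fun _ hy => hy.symm)))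

theorem mul_mem_span_basisFun {N : Set (isolatedPart T)} {f g : C(T, 𝕜)}
    (hf : f ∈ Submodule.span 𝕜 (basisFun 𝕜 '' N)) (hg : g ∈ Submodule.span 𝕜 (basisFun 𝕜 '' N)) :
    f * g ∈ Submodule.span 𝕜 (basisFun 𝕜 '' N) := by
  have h := Submodule.mul_mem_mul hf hg
  rw [Submodule.span_mul_span] at h
  refine Submodule.span_le.2 ?_ h
  rintro _ ⟨_, ⟨x, hx, rfl⟩, _, ⟨y, hy, rfl⟩, rfl⟩
  change basisFun 𝕜 x * basisFun 𝕜 y ∈ Submodule.span 𝕜 (basisFun 𝕜 '' N)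
  by_cases h1 : (x : T) ≤ y
  · rw [basisFun_mul_of_le h1]
    exact Submodule.subset_span ⟨y, hy, rfl⟩
  by_cases h2 : (y : T) ≤ x
  · rw [mul_comm, basisFun_mul_of_le h2]
    exact Submodule.subset_span ⟨x, hx, rfl⟩
  · rw [basisFun_mul_of_incomparable h1 h2]
    exact Submodule.zero_mem _

theorem star_mem_span_basisFun {N : Set (isolatedPart T)} {f : C(T, 𝕜)}
    (hf : f ∈ Submodule.span 𝕜 (basisFun 𝕜 '' N)) :
    star f ∈ Submodule.span 𝕜 (basisFun 𝕜 '' N) := by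
  induction hf using Submodule.span_induction with
  | mem x hx =>
    obtain ⟨y, hy, rfl⟩ := hx
    rw [star_basisFun]
    exact Submodule.subset_span ⟨y, hy, rfl⟩
  | zero => rw [star_zero]; exact Submodule.zero_mem _
  | add x y _ _ hx hy => rw [star_add]; exact Submodule.add_mem _ hx hy
  | smul a x _ hx => rw [star_smul]; exact Submodule.smul_mem _ _ hx

/-- The linear span of the `g_x`, `x ∈ N`, as a star subalgebra, if `N` contains the root. -/
def spanStarSubalgebra (𝕜 : Type v) [RCLike 𝕜] (N : Set (isolatedPart T))
    (hN : ⟨⊥, bot_mem_isolatedPart⟩ ∈ N) : StarSubalgebra 𝕜 C(T, 𝕜) where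
  carrier := Submodule.span 𝕜 (basisFun 𝕜 '' N)
  mul_mem' := mul_mem_span_basisFun
  add_mem' := Submodule.add_mem _
  algebraMap_mem' r := by
    rw [Algebra.algebraMap_eq_smul_one, ← basisFun_bot]
    exact Submodule.smul_mem _ _ (Submodule.subset_span ⟨_, hN, rfl⟩)
  star_mem' := star_mem_span_basisFun

/-- The Stone–Weierstrass theorem for star subalgebras which need not separate points. -/
theorem mem_topologicalClosure_of_forall_apply_eq {X : Type*} [TopologicalSpace X] [CompactSpace X]
    (A : StarSubalgebra 𝕜 C(X, 𝕜)) (f : C(X, 𝕜))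
    (hf : ∀ s t : X, (∀ g ∈ A, g s = g t) → f s = f t) : f ∈ A.topologicalClosure := by
  let Φ : X → A → 𝕜 := fun t g => (g : C(X, 𝕜)) t
  have hΦ : Continuous Φ := continuous_pi fun g => (g : C(X, 𝕜)).continuous
  -- Points which `A` does not separate are collapsed. `K` is compact Hausdorff, so the surjection
  -- `q` is closed, hence a quotient map, and `f` descends to `K`.
  let K := range Φ
  have : CompactSpace K := isCompact_iff_compactSpace.1 (isCompact_range hΦ)
  let q : C(X, K) := ⟨rangeFactorization Φ, hΦ.subtype_mk _⟩
  have hq : IsQuotientMap q :=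
    q.continuous.isClosedMap.isQuotientMap q.continuous rangeFactorization_surjective
  have hcomp : Continuous (ContinuousMap.compStarAlgHom' 𝕜 𝕜 q) :=
    ContinuousMap.continuous_precomp q
  -- Pulling back the closure of `A` makes `B` closed; separating points, it is then all of `C(K)`.
  let B : StarSubalgebra 𝕜 C(K, 𝕜) := 
    A.topologicalClosure.comap (ContinuousMap.compStarAlgHom' 𝕜 𝕜 q)
  have hBclosed : IsClosed (B : Set C(K, 𝕜)) :=
    A.isClosed_topologicalClosure.preimage hcomp
  have hB : B.SeparatesPoints := by
    intro a b hab
    obtain ⟨g, hg⟩ : ∃ g : A, (a : A → 𝕜) g ≠ (b : A → 𝕜) g := by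
      by_contra hne
      push Not at hne
      exact hab (Subtype.ext (funext hne))
    refine ⟨_, ⟨⟨fun k : K => (k : A → 𝕜) g, (continuous_apply g).comp continuous_subtype_val⟩,
      ?_, rfl⟩, hg⟩
    exact A.le_topologicalClosure g.2
  have htop := ContinuousMap.starSubalgebra_topologicalClosure_eq_top_of_separatesPoints B hB
  let h : C(K, 𝕜) := hq.lift f fun s t hst => hf s t fun g hg =>
    congrFun (congrArg Subtype.val hst) ⟨g, hg⟩
  have hh : h.comp q = f := hq.lift_comp f _
  have hmem : h ∈ B.topologicalClosure := htop ▸ trivial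
  rw [← SetLike.mem_coe, StarSubalgebra.topologicalClosure_coe, hBclosed.closure_eq] at hmem
  rw [← hh]
  exact hmem

theorem mem_closure_span_of_bot_mem (f : C(T, 𝕜)) (N : Set (isolatedPart T))
    (hN : ⟨⊥, bot_mem_isolatedPart⟩ ∈ N) (hfN : ∀ x, basisFunctional 𝕜 x f ≠ 0 → x ∈ N) :
    f ∈ closure (Submodule.span 𝕜 (basisFun 𝕜 '' N) : Set C(T, 𝕜)) := by
  have key : ∀ s t : T, (∀ g ∈ spanStarSubalgebra 𝕜 N hN, g s = g t) → f s = f (wedge s t) := by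
    intro s t h
    have hw := isGreatest_wedge s t
    refine apply_eq_of_basisFunctional_eq_zero f hw.1.1 fun x hwx hxs => ?_
    by_contra hne
    have h1 := h (basisFun 𝕜 x) (Submodule.subset_span ⟨x, hfN x hne, rfl⟩)
    rw [basisFun_apply_of_le hxs] at h1
    exact (hw.2 ⟨hxs, basisFun_apply_eq_one_iff.1 h1.symm⟩).not_gt hwx
  have hcomm : ∀ s t : T, wedge s t = wedge t s := fun s t => by
    rw [wedge, wedge, inter_comm]
  refine mem_topologicalClosure_of_forall_apply_eq (spanStarSubalgebra 𝕜 N hN) f fun s t h => ?_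
  rw [key s t h, key t s fun g hg => (h g hg).symm, hcomm]

theorem mem_closure_span_basisFun (f : C(T, 𝕜)) :
    f ∈ closure (Submodule.span 𝕜 (basisFun 𝕜 '' {x | basisFunctional 𝕜 x f ≠ 0}) :
      Set C(T, 𝕜)) := by
  by_cases h0 : f ⊥ = 0
  · have h1 := mem_closure_span_of_bot_mem f
      (insert ⟨⊥, bot_mem_isolatedPart⟩ {x | basisFunctional 𝕜 x f ≠ 0}) (mem_insert _ _)
      fun x hx => mem_insert_of_mem _ hx
    -- The root was added to the index set only to have constants. The map `g ↦ g - g(⊥)·1` removes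
    -- it again: it kills `g_⊥ = 1`, fixes every other `g_x`, and fixes `f` because `f ⊥ = 0`.
    let E : C(T, 𝕜) →L[𝕜] C(T, 𝕜) := ContinuousLinearMap.id 𝕜 _ -
      (ContinuousMap.evalCLM 𝕜 (⊥ : T)).smulRight (1 : C(T, 𝕜))
    have hE : ∀ g, E g = g - g ⊥ • (1 : C(T, 𝕜)) := fun g => by
      ext t
      simp [E]
    have hEf : E f = f := by rw [hE, h0, zero_smul, sub_zero]
    refine (congrArg (· ∈ closure _) hEf).mp (map_mem_closure E.continuous h1 fun g hg => ?_)
    refine Submodule.span_le (p := (Submodule.span 𝕜 (basisFun 𝕜 ''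
      {x | basisFunctional 𝕜 x f ≠ 0})).comap E.toLinearMap) |>.2 ?_ hg
    rintro _ ⟨x, hx, rfl⟩
    change E (basisFun 𝕜 x) ∈ Submodule.span 𝕜 _
    by_cases hx0 : (x : T) = ⊥
    · obtain rfl : x = ⟨⊥, bot_mem_isolatedPart⟩ := Subtype.ext hx0
      rw [hE, basisFun_bot, ContinuousMap.one_apply, one_smul, sub_self]
      exact Submodule.zero_mem _
    · rw [hE, basisFun_apply_of_not_le (fun h => hx0 (le_bot_iff.1 h)), zero_smul, sub_zero]
      refine Submodule.subset_span ⟨x, hx.resolve_left fun h => hx0 (congrArg Subtype.val h), rfl⟩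
  · exact mem_closure_span_of_bot_mem f _ (by
      rw [mem_ofPred_eq, basisFunctional_of_eq_bot rfl]; exact h0) fun x hx => hx

theorem isStrongMarkushevichBasis_basisFun :
    IsStrongMarkushevichBasis (basisFun (T := T) 𝕜) (basisFunctional (T := T) 𝕜) where
  apply_self x := by
    by_cases hx : (x : T) = ⊥
    · rw [basisFunctional_of_eq_bot hx, basisFun_apply_of_le hx.le]
    · rw [basisFunctional_of_ne_bot hx, basisFun_apply_of_le le_rfl,
        basisFun_apply_of_not_le (predecessor_covBy x.2 hx).1.not_ge, sub_zero]
  apply_of_ne x y hxy := by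
    have hne : (y : T) ≠ x := fun h => hxy (Subtype.ext h.symm)
    by_cases hx : (x : T) = ⊥
    · rw [basisFunctional_of_eq_bot hx, basisFun_apply_of_not_le fun h =>
        hne ((le_bot_iff.1 h).trans hx.symm)]
    · rw [basisFunctional_of_ne_bot hx, sub_eq_zero]
      refine basisFun_apply_congr ?_
      rw [le_predecessor_iff x.2 hx, lt_iff_le_and_ne]
      exact ⟨fun h => ⟨h, hne⟩, fun h => h.1⟩
  closure_span := eq_univ_of_forall fun f => closure_mono
    (Submodule.span_mono (image_subset_range _ _)) (mem_closure_span_basisFun f)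
  separates f g hfg := by
    by_contra hne
    push Not at hne
    -- All `ν_x` vanish on `f - g`, so `f - g` lies in the closed span of the empty set.
    have h := mem_closure_span_basisFun (f - g)
    have hempty : {x : isolatedPart T | basisFunctional 𝕜 x (f - g) ≠ 0} = ∅ :=
      eq_empty_of_forall_notMem fun x hx => hx (by rw [map_sub, hne, sub_self])
    rw [hempty, image_empty, Submodule.span_empty, Submodule.bot_coe, closure_singleton,
      mem_singleton_iff, sub_eq_zero] at h
    exact hfg h
  mem_closure_span := mem_closure_span_basisFun

end Basis

/-! ### Dirac measures, supports and the topology σ. -/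

section Measure

open MeasureTheory

theorem isRadon_dirac {K : Type u} [TopologicalSpace K] [T1Space K] [MeasurableSpace K]
    [BorelSpace K] {𝕜 : Type v} [RCLike 𝕜] (s : K) :
    IsRadon (VectorMeasure.dirac s (1 : 𝕜)) := by
  have hv : (VectorMeasure.dirac s (1 : 𝕜)).variation = Measure.dirac s := by
    rw [VectorMeasure.variation_dirac, enorm_one, one_smul]
  refine ⟨inferInstance, ?_⟩
  rw [hv]
  refine { outerRegular := ?_, innerRegular := ?_ }
  · intro A hA r hr
    by_cases hs : s ∈ A
    · refine ⟨univ, subset_univ A, isOpen_univ, ?_⟩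
      rwa [Measure.dirac_apply_of_mem (mem_univ s), ← Measure.dirac_apply_of_mem hs]
    · refine ⟨{s}ᶜ, fun x hx hxs => hs (mem_singleton_iff.1 hxs ▸ hx), isOpen_compl_singleton, ?_⟩
      rw [Measure.dirac_apply' s (measurableSet_singleton s).compl,
        indicator_of_notMem (not_not.2 rfl)]
      exact pos_of_gt hr
  · intro U hU r hr
    have hs : s ∈ U := by
      by_contra hs
      rw [Measure.dirac_apply' s hU.measurableSet, indicator_of_notMem hs] at hr
      exact not_lt_zero hr
    refine ⟨{s}, singleton_subset_iff.2 hs, isCompact_singleton, ?_⟩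
    rwa [Measure.dirac_apply_of_mem (mem_singleton s), ← Measure.dirac_apply_of_mem hs]

theorem support_variation_dirac_subset {K : Type u} [TopologicalSpace K] [T1Space K]
    [MeasurableSpace K] [BorelSpace K] {𝕜 : Type v} [RCLike 𝕜] (s : K) :
    (VectorMeasure.dirac s (1 : 𝕜)).variation.support ⊆ {s} := by
  rw [VectorMeasure.variation_dirac, enorm_one, one_smul]
  refine Measure.support_subset_of_isClosed isClosed_singleton ?_
  rw [mem_ae_iff, Measure.dirac_apply' s (measurableSet_singleton s).compl,
    indicator_of_notMem (not_not.2 rfl)]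

theorem pairing_dirac {K : Type u} [TopologicalSpace K] [T1Space K] [MeasurableSpace K]
    [BorelSpace K] {𝕜 : Type v} [RCLike 𝕜] (f : C(K, 𝕜)) (s : K) :
    pairing f (VectorMeasure.dirac s (1 : 𝕜)) = f s := by
  rw [pairing, VectorMeasure.integral_dirac]
  simp

theorem pairing_zero {K : Type u} [TopologicalSpace K] [MeasurableSpace K] {𝕜 : Type v} [RCLike 𝕜]
    (μ : VectorMeasure K 𝕜) : pairing (0 : C(K, 𝕜)) μ = 0 :=
  VectorMeasure.integral_zero

/-- Regularity is what makes the complement of the support a null set here; the space need not be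
second countable. -/
theorem pairing_congr_of_eqOn_support {K : Type u} [TopologicalSpace K] [MeasurableSpace K]
    {𝕜 : Type v} [RCLike 𝕜] {f g : C(K, 𝕜)} {μ : VectorMeasure K 𝕜} (hμ : IsRadon μ)
    (h : EqOn f g μ.variation.support) : pairing f μ = pairing g μ := by
  have := hμ.2
  refine VectorMeasure.integral_congr_ae ?_
  filter_upwards [Measure.support_mem_ae_of_regular (μ := μ.variation)] with t ht using h ht

theorem tendsto_nhds_sigmaTopology {K : Type u} [TopologicalSpace K] [MeasurableSpace K]
    {𝕜 : Type v} [RCLike 𝕜] {D : Set (VectorMeasure K 𝕜)} {ι : Type*} {g : ι → C(K, 𝕜)}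
    {l : Filter ι} {f : C(K, 𝕜)} :
    Filter.Tendsto g l (@nhds _ (sigmaTopology D) f) ↔
      ∀ μ ∈ D, Filter.Tendsto (fun i => pairing (g i) μ) l (𝓝 (pairing f μ)) := by
  simp only [nhds_iInf, nhds_induced, Filter.tendsto_iInf, Filter.tendsto_comap_iff]
  rfl

variable {T : Type u} [PartialOrder T] [OrderBot T] [ChainCompleteTree T] [TopologicalSpace T]
  [CoarseWedgeTopology T] [MeasurableSpace T] [BorelSpace T] {𝕜 : Type v} [RCLike 𝕜]

theorem continuous_apply_sigmaTopology {s : T} (hs : s ∈ countablePart T) :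
    Continuous[sigmaTopology (measureSpaceD T 𝕜), _] (fun f : C(T, 𝕜) => f s) := by
  have hmem : VectorMeasure.dirac s (1 : 𝕜) ∈ measureSpaceD T 𝕜 :=
    ⟨isRadon_dirac s, (support_variation_dirac_subset s).trans (singleton_subset_iff.2 hs)⟩
  have h : (fun f : C(T, 𝕜) => f s) = fun f => pairing f (VectorMeasure.dirac s (1 : 𝕜)) :=
    funext fun f => (pairing_dirac f s).symm
  rw [h]
  exact continuous_iInf_dom (continuous_iInf_dom (i := hmem) continuous_induced_dom)

theorem not_accPt_of_isOpen {X : Type*} [TopologicalSpace X] {x : X} {C U : Set X}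
    (hU : IsOpen U) (hx : x ∈ U) (h : ∀ y ∈ U, y ∈ C → y = x) :
    ¬ AccPt x (Filter.principal C) := by
  rw [accPt_iff_frequently, Filter.not_frequently]
  filter_upwards [hU.mem_nhds hx] with y hy hyC
  exact hyC.1 (h y hy hyC.2)

theorem enorm_pairing_basisFun_le (x : isolatedPart T) (μ : VectorMeasure T 𝕜) :
    ‖pairing (basisFun 𝕜 x) μ‖ₑ ≤
      ‖ContinuousLinearMap.mul ℝ 𝕜‖ₑ * μ.variation (Ici (x : T)) := by
  refine VectorMeasure.enorm_integral_le_lintegral_enorm.trans ?_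
  gcongr
  rw [← lintegral_indicator_one (isClopen_Ici x.2).2.measurableSet]
  refine lintegral_mono fun t => ?_
  by_cases ht : (x : T) ≤ t
  · rw [basisFun_apply_of_le ht, indicator_of_mem (mem_Ici.2 ht), enorm_one, Pi.one_apply]
  · rw [basisFun_apply_of_not_le ht, enorm_zero]
    exact zero_le

end Measure

/-! ### The set `H`: projections, closedness, accumulation points. -/

section Accumulation

open MeasureTheory

variable {T : Type u} [PartialOrder T] [OrderBot T] [ChainCompleteTree T] [TopologicalSpace T]
  [CoarseWedgeTopology T] {𝕜 : Type v} [RCLike 𝕜]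

theorem proj_mem_basisSet {A : Set T} (hA : A ∈ wedgeFamily T) {f : C(T, 𝕜)}
    (hf : f ∈ basisSet T 𝕜) : proj A hA.1 f ∈ basisSet T 𝕜 := by
  obtain ⟨x, rfl⟩ | rfl := hf
  swap
  · exact Or.inr rfl
  have hr := isGreatest_retr hA.1.1 hA.1.2.1
  have hval : ∀ t, proj A hA.1 (basisFun 𝕜 x) t = basisFun 𝕜 x (retr A t) := fun t => rfl
  by_cases hne : ∃ a ∈ A, (x : T) ≤ a
  · obtain ⟨a, haA, hxa⟩ := hne
    -- This `y` is least only in `A ∩ [x, a]`; closure of `A` under `∧` puts it below every element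
    -- of `A ∩ V_x`. Hence `P_A g_x = g_y`.
    obtain ⟨y, ⟨⟨hyA, hxy⟩, hya⟩, hmin⟩ := exists_isLeast_of_subset_Iic
      (s := A ∩ Ici (x : T) ∩ Iic a) (t := a) ⟨a, ⟨haA, hxa⟩, le_rfl⟩ inter_subset_right
    have hret : ∀ t, (x : T) ≤ retr A t ↔ y ≤ t := by
      intro t
      constructor
      · intro hxt
        have hw := isGreatest_wedge (retr A t) y
        exact (hmin ⟨⟨hA.2 _ (hr t).1.1 _ hyA, hw.2 ⟨hxt, hxy⟩⟩, hw.1.2.trans hya⟩).trans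
          (hw.1.1.trans (hr t).1.2)
      · exact fun hyt => le_trans hxy ((hr t).2 ⟨hyA, hyt⟩)
    have hy : y ∈ isolatedPart T := by
      refine mem_isolatedPart_of_isOpen_Ici ?_
      have : Ici y = retr A ⁻¹' Ici (x : T) := ext fun t => (hret t).symm
      rw [this]
      exact (isClopen_Ici x.2).2.preimage hA.1.2.2
    refine Or.inl ⟨⟨y, hy⟩, ContinuousMap.ext fun t => ?_⟩
    rw [hval]
    exact basisFun_apply_congr (hret t).symm
  · push Not at hne
    refine Or.inr (ContinuousMap.ext fun t => ?_)
    rw [hval, basisFun_apply_of_not_le (hne _ (hr t).1.1), ContinuousMap.zero_apply]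

theorem apply_mem_of_mem_basisSet {f : C(T, 𝕜)} (hf : f ∈ basisSet T 𝕜) (t : T) :
    f t ∈ ({0, 1} : Set 𝕜) := by
  obtain ⟨x, rfl⟩ | rfl := hf
  · by_cases hx : (x : T) ≤ t
    · exact Or.inr (basisFun_apply_of_le hx)
    · exact Or.inl (basisFun_apply_of_not_le hx)
  · exact Or.inl rfl

theorem apply_eq_one_of_mem_basisSet {f : C(T, 𝕜)} (hf : f ∈ basisSet T 𝕜) {s t : T}
    (hs : f s = 1) (ht : f t = 1) : f (wedge s t) = 1 := by
  obtain ⟨x, rfl⟩ | rfl := hf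
  · exact basisFun_apply_of_le ((isGreatest_wedge s t).2
      ⟨basisFun_apply_eq_one_iff.1 hs, basisFun_apply_eq_one_iff.1 ht⟩)
  · exact absurd hs zero_ne_one

theorem apply_eq_one_of_mem_basisSet_of_le {f : C(T, 𝕜)} (hf : f ∈ basisSet T 𝕜) {s t : T}
    (hst : s ≤ t) (hs : f s = 1) : f t = 1 := by
  obtain ⟨x, rfl⟩ | rfl := hf
  · exact basisFun_apply_of_le ((basisFun_apply_eq_one_iff.1 hs).trans hst)
  · exact absurd hs zero_ne_one

theorem accPt_basisSet_of_tendsto {τ : TopologicalSpace C(T, 𝕜)} {f : C(T, 𝕜)}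
    {l : Filter (isolatedPart T)} [l.NeBot] (hl : Filter.Tendsto (basisFun 𝕜) l (@nhds _ τ f))
    (hne : ∀ᶠ y in l, basisFun 𝕜 y ≠ f) : AccPt f (Filter.principal (basisSet T 𝕜)) := by
  rw [accPt_iff_frequently]
  exact hl.frequently (hne.frequently.mono fun y hy => ⟨hy, Or.inl ⟨y, rfl⟩⟩)

variable [MeasurableSpace T] [BorelSpace T]

/-- The value triples of members of `H` form a finite, hence closed, set, so approximation becomes
equality. Three points are needed for two elements and their meet. -/
theorem exists_mem_basisSet_apply_eq {f : C(T, 𝕜)}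
    (hf : f ∈ @closure _ (sigmaTopology (measureSpaceD T 𝕜)) (basisSet T 𝕜)) {a b c : T}
    (ha : a ∈ countablePart T) (hb : b ∈ countablePart T) (hc : c ∈ countablePart T) :
    ∃ h ∈ basisSet T 𝕜, h a = f a ∧ h b = f b ∧ h c = f c := by
  let τ : TopologicalSpace C(T, 𝕜) := sigmaTopology (measureSpaceD T 𝕜)
  let Ψ : C(T, 𝕜) → 𝕜 × 𝕜 × 𝕜 := fun f => (f a, f b, f c)
  have hΨ : Continuous[τ, _] Ψ := (continuous_apply_sigmaTopology ha).prodMk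
    ((continuous_apply_sigmaTopology hb).prodMk (continuous_apply_sigmaTopology hc))
  have hfin : (Ψ '' basisSet T 𝕜).Finite := by
    refine ((toFinite ({0, 1} : Set 𝕜)).prod ((toFinite ({0, 1} : Set 𝕜)).prod
      (toFinite ({0, 1} : Set 𝕜)))).subset ?_
    rintro _ ⟨h, hh, rfl⟩
    exact ⟨apply_mem_of_mem_basisSet hh a, apply_mem_of_mem_basisSet hh b,
      apply_mem_of_mem_basisSet hh c⟩
  have hmem : Ψ f ∈ Ψ '' basisSet T 𝕜 := by
    rw [← hfin.isClosed.closure_eq]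
    exact image_closure_subset_closure_image hΨ ⟨f, hf, rfl⟩
  obtain ⟨h, hh, he⟩ := hmem
  simp only [Ψ, Prod.mk.injEq] at he
  exact ⟨h, hh, he⟩

theorem isClosed_basisSet (hT : IsROneTree T) :
    IsClosed[sigmaTopology (measureSpaceD T 𝕜)] (basisSet T 𝕜) := by
  let τ : TopologicalSpace C(T, 𝕜) := sigmaTopology (measureSpaceD T 𝕜)
  refine (@isClosed_of_closure_subset _ τ _) fun f hf => ?_
  have hI := isolatedPart_subset_countablePart (T := T)
  -- Outside `S(T)` the values of `f` are reached only as limits over isolated elements of the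
  -- branch.
  have hlim : ∀ u : T, Filter.Tendsto (fun y : isolatedPart T => f y) (branchFilter u) (𝓝 (f u)) :=
    fun u => (f.continuous.tendsto u).comp (tendsto_branchFilter u)
  have h01 : ∀ u, f u ∈ ({0, 1} : Set 𝕜) := fun u => by
    refine (toFinite ({0, 1} : Set 𝕜)).isClosed.mem_of_tendsto (hlim u)
      (Filter.Eventually.of_forall fun y => ?_)
    obtain ⟨h, hh, he, -⟩ := exists_mem_basisSet_apply_eq hf (hI y.2) (hI y.2) (hI y.2)
    rw [← he]
    exact apply_mem_of_mem_basisSet hh y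
  have hmono : ∀ a ∈ isolatedPart T, f a = 1 → ∀ u, a ≤ u → f u = 1 := fun a ha hfa u hau => by
    refine tendsto_nhds_unique (hlim u) (tendsto_const_nhds.congr' ?_)
    filter_upwards [eventually_branchFilter_ge ha hau] with y hy
    obtain ⟨h, hh, he1, he2, -⟩ := exists_mem_basisSet_apply_eq hf (hI ha) (hI y.2) (hI y.2)
    rw [← he2]
    exact (apply_eq_one_of_mem_basisSet_of_le hh hy (he1.trans hfa)).symm
  have hbelow : ∀ u, f u = 1 → ∀ᶠ y : isolatedPart T in branchFilter u, f y = 1 := fun u hu => by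
    filter_upwards [(hlim u).eventually_ne (hu ▸ one_ne_zero)] with y hy
    exact (h01 y).resolve_left hy
  by_cases hzero : ∀ u, f u = 0
  · exact Or.inr (ContinuousMap.ext hzero)
  push Not at hzero
  obtain ⟨s, hs⟩ := hzero
  obtain ⟨u, ⟨hfu, hus⟩, hmin⟩ := exists_isLeast_of_subset_Iic
    (s := {u | f u = 1 ∧ u ≤ s}) (t := s) ⟨s, (h01 s).resolve_left hs, le_rfl⟩ fun a ha => ha.2
  have hu : u ∈ isolatedPart T := by
    obtain ⟨y, hy, hyu⟩ := ((hbelow u hfu).and (eventually_branchFilter_le u)).exists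
    exact le_antisymm hyu (hmin ⟨hy, hyu.trans hus⟩) ▸ y.2
  have hisol : ∀ t ∈ isolatedPart T, f t = 1 → u ≤ t := by
    intro t ht hft
    by_contra hut
    have hw := isGreatest_wedge t u
    have hwu : wedge t u < u := lt_of_le_of_ne hw.1.2 fun he => hut (he ▸ hw.1.1)
    -- If the meet lies in `S(T)`, the three-point test gives `f = 1` there, against the minimality
    -- of `u`. If not, the `r₁` condition makes the branches to `t` and `u` share the successor of
    -- their meet, which is absurd.
    by_cases hwS : wedge t u ∈ countablePart T
    · obtain ⟨h, hh, he1, he2, he3⟩ := exists_mem_basisSet_apply_eq hf (hI ht) (hI hu) hwS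
      have := apply_eq_one_of_mem_basisSet hh (he1.trans hft) (he2.trans hfu)
      exact (hmin ⟨he3.symm.trans this, hwu.le.trans hus⟩).not_gt hwu
    · have hwt : wedge t u < t := lt_of_le_of_ne hw.1.1 fun he =>
        hwS (by rw [he]; exact hI ht)
      obtain ⟨p, hp, hpt⟩ := exists_covBy_le hwt
      obtain ⟨q, hq, hqu⟩ := exists_covBy_le hwu
      obtain rfl : p = q := hT _ (not_le.1 hwS) hp hq
      exact (hw.2 ⟨hpt, hqu⟩).not_gt hp.1
  refine Or.inl ⟨⟨u, hu⟩, ContinuousMap.ext fun t => ?_⟩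
  by_cases hut : u ≤ t
  · rw [basisFun_apply_of_le hut, hmono u hu hfu t hut]
  · rw [basisFun_apply_of_not_le hut]
    refine ((h01 t).resolve_right fun hft => hut ?_).symm
    obtain ⟨y, hy, hyt⟩ := ((hbelow t hft).and (eventually_branchFilter_le t)).exists
    exact (hisol y y.2 hy).trans hyt

omit [BorelSpace T] in
-- By the `r₁` condition `V_{x⁻} = {x⁻} ∪ V_x`, and `x⁻` avoids the support of `μ`. So for isolated
-- `y` close below `x⁻`, `g_y` and `g_x` agree on that support.
theorem accPt_basisFun (hT : IsROneTree T) {x : isolatedPart T} (hx : (x : T) ≠ ⊥)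
    (hcof : Cardinal.aleph0 < cofinality (predecessor (x : T))) :
    @AccPt _ (sigmaTopology (measureSpaceD T 𝕜)) (basisFun 𝕜 x)
      (Filter.principal (basisSet T 𝕜)) := by
  have hcov := predecessor_covBy x.2 hx
  refine accPt_basisSet_of_tendsto (l := branchFilter (predecessor (x : T)))
    (tendsto_nhds_sigmaTopology.2 fun μ hμ => ?_) ?_
  · have hw : predecessor (x : T) ∉ μ.variation.support := fun h => (hμ.2 h).not_gt hcof
    have hsub : Ici (predecessor (x : T)) ⊆ Ici (x : T) ∪ μ.variation.supportᶜ := fun z hz => by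
      rcases (mem_Ici.1 hz).eq_or_lt with rfl | hlt
      · exact Or.inr hw
      · obtain ⟨s, hs, hsz⟩ := exists_covBy_le hlt
        exact Or.inl ((hT _ hcof hs hcov) ▸ hsz)
    refine tendsto_const_nhds.congr' ?_
    filter_upwards [eventually_branchFilter_le _, eventually_branchFilter_Ici_subset
      ((isClopen_Ici x.2).2.union Measure.isOpen_compl_support) hsub] with y hy hyU
    refine pairing_congr_of_eqOn_support hμ.1 fun t ht => basisFun_apply_congr
      ⟨(hy.trans hcov.1.le).trans, fun hyt => ?_⟩
    exact (hyU hyt).resolve_right fun h => h ht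
  · filter_upwards [eventually_branchFilter_le _] with y hy he
    exact (hy.trans_lt hcov.1).ne (congrArg Subtype.val (basisFun_injective he))

theorem accPt_basisSet_iff (hT : IsROneTree T) {f : C(T, 𝕜)} (hf : f ≠ 0) :
    @AccPt _ (sigmaTopology (measureSpaceD T 𝕜)) f (Filter.principal (basisSet T 𝕜)) ↔
      ∃ x : isolatedPart T, (x : T) ≠ ⊥ ∧
        Cardinal.aleph0 < cofinality (predecessor (x : T)) ∧ f = basisFun 𝕜 x := by
  let τ : TopologicalSpace C(T, 𝕜) := sigmaTopology (measureSpaceD T 𝕜)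
  constructor
  · intro h
    have hmem : f ∈ basisSet T 𝕜 :=
      (isClosed_iff_clusterPt (s := basisSet T 𝕜)).1 (isClosed_basisSet hT) f h.clusterPt
    obtain ⟨x, rfl⟩ := hmem.resolve_right hf
    have hopen : ∀ {s : T}, s ∈ countablePart T → ∀ c : 𝕜,
        IsOpen[τ] {h : C(T, 𝕜) | h s ≠ c} := fun hs c =>
      isOpen_compl_singleton.preimage (continuous_apply_sigmaTopology hs)
    have hU := hopen (isolatedPart_subset_countablePart x.2) 0
    have hxx : basisFun 𝕜 x (x : T) ≠ 0 := by
      rw [basisFun_apply_of_le le_rfl]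
      exact one_ne_zero
    have hx0 : (x : T) ≠ ⊥ := fun hx0 => by
      refine not_accPt_of_isOpen hU hxx ?_ h
      rintro _ hy (⟨y, rfl⟩ | rfl)
      · have hyx := not_not.1 (mt basisFun_apply_eq_zero_iff.2 hy)
        exact congrArg _ (Subtype.ext ((le_bot_iff.1 (hyx.trans hx0.le)).trans hx0.symm))
      · exact absurd rfl hy
    refine ⟨x, hx0, ?_, rfl⟩
    by_contra hcof
    have hcov := predecessor_covBy x.2 hx0
    -- The conditions `h x ≠ 0` and `h x⁻ ≠ 1` isolate `g_x` in `H`: for `h = g_y` they say `y ≤ x`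
    -- and not `y < x`.
    refine not_accPt_of_isOpen (hU.inter (hopen (not_lt.1 hcof) 1)) ⟨hxx, ?_⟩ ?_ h
    · change basisFun 𝕜 x (predecessor (x : T)) ≠ 1
      rw [basisFun_apply_of_not_le hcov.1.not_ge]
      exact zero_ne_one
    · rintro _ ⟨hy, hyp⟩ (⟨y, rfl⟩ | rfl)
      · have hyx := not_not.1 (mt basisFun_apply_eq_zero_iff.2 hy)
        have hyp' := mt basisFun_apply_of_le hyp
        rw [le_predecessor_iff x.2 hx0] at hyp'
        exact congrArg _ (Subtype.ext (hyx.eq_of_not_lt hyp'))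
      · exact absurd rfl hy
  · rintro ⟨x, hx0, hcof, rfl⟩
    exact accPt_basisFun hT hx0 hcof

omit [BorelSpace T] in
theorem accPt_zero_of_isMax {m : T} (hm : IsMax m) (hcof : Cardinal.aleph0 < cofinality m) :
    @AccPt _ (sigmaTopology (measureSpaceD T 𝕜)) 0 (Filter.principal (basisSet T 𝕜)) := by
  refine accPt_basisSet_of_tendsto (l := branchFilter m)
    (tendsto_nhds_sigmaTopology.2 fun μ hμ => ?_)
    (Filter.Eventually.of_forall fun y => basisFun_ne_zero y)
  have hw : m ∉ μ.variation.support := fun h => (hμ.2 h).not_gt hcof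
  refine tendsto_const_nhds.congr' ?_
  filter_upwards [eventually_branchFilter_Ici_subset (w := m) Measure.isOpen_compl_support
    (fun z hz => (hm.eq_of_le hz) ▸ hw)] with y hyU
  exact pairing_congr_of_eqOn_support hμ.1 fun t ht =>
    (basisFun_apply_of_not_le fun hyt => hyU hyt ht).symm

theorem tendsto_measure_singleton_cofinite {X : Type*} [MeasurableSpace X]
    [MeasurableSingletonClass X] (μ : Measure X) [IsFiniteMeasure μ] (M : Set X) :
    Filter.Tendsto (fun m : M => μ {(m : X)}) Filter.cofinite (𝓝 0) := by
  refine ENNReal.tendsto_cofinite_zero_of_tsum_ne_top (ne_top_of_le_ne_top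
    (measure_ne_top μ (⋃ m : M, {(m : X)})) ?_)
  refine tsum_meas_le_meas_iUnion_of_disjoint μ (fun m => measurableSet_singleton _)
    fun a b hab => ?_
  exact disjoint_singleton.2 fun h => hab (Subtype.ext h)

theorem accPt_zero_of_infinite (hinf : {m : T | IsMax m}.Infinite) :
    @AccPt _ (sigmaTopology (measureSpaceD T 𝕜)) 0 (Filter.principal (basisSet T 𝕜)) := by
  have := hinf.to_subtype
  -- First choose a maximal `m` outside a finite set, then an isolated `y` close below `m`. The mass
  -- at `m` is small, and outer regularity together with `V_m = {m}` makes the mass of `V_y` small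
  -- too.
  let l : Filter (isolatedPart T) :=
    (Filter.cofinite : Filter {m : T | IsMax m}).bind fun m => branchFilter (m : T)
  have hl : l.NeBot := by
    refine Filter.neBot_iff.2 fun hbot => ?_
    obtain ⟨m, hm⟩ := (Filter.eventually_bind.1
      (Filter.eventually_false_iff_eq_bot.2 hbot)).exists
    exact (neBot_branchFilter (m : T)).ne (Filter.eventually_false_iff_eq_bot.1 hm)
  refine accPt_basisSet_of_tendsto (l := l)
    (tendsto_nhds_sigmaTopology.2 fun μ hμ => ?_)
    (Filter.Eventually.of_forall fun y => basisFun_ne_zero y)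
  have := hμ.1.1
  have := hμ.1.2
  have hmeas : Filter.Tendsto (fun y : isolatedPart T => μ.variation (Ici (y : T))) l (𝓝 0) := by
    rw [ENNReal.tendsto_nhds_zero]
    intro ε hε
    refine Filter.eventually_bind.2 ?_
    filter_upwards [(tendsto_measure_singleton_cofinite μ.variation
      {m : T | IsMax m}).eventually_lt_const hε] with m hm
    obtain ⟨U, hmU, hU, hlt⟩ := Set.exists_isOpen_lt_of_lt ({(m : T)} : Set T) ε hm
    filter_upwards [eventually_branchFilter_Ici_subset (w := (m : T)) hU
      (fun z hz => hmU (m.2.eq_of_le hz).symm)] with y hy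
    exact (measure_mono hy).trans hlt.le
  rw [pairing_zero, tendsto_zero_iff_enorm_tendsto_zero]
  have hmul := ENNReal.Tendsto.const_mul hmeas
    (Or.inr (enorm_ne_top (x := ContinuousLinearMap.mul ℝ 𝕜)))
  rw [mul_zero] at hmul
  exact tendsto_of_tendsto_of_tendsto_of_le_of_le tendsto_const_nhds hmul (fun _ => zero_le)
    fun y => enorm_pairing_basisFun_le y μ

theorem accPt_zero_iff :
    @AccPt _ (sigmaTopology (measureSpaceD T 𝕜)) 0 (Filter.principal (basisSet T 𝕜)) ↔
      ({m : T | IsMax m}.Infinite ∨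
        ∃ m : T, IsMax m ∧ Order.IsSuccLimit (height m) ∧
          Cardinal.aleph0 < cofinality m) := by
  let τ : TopologicalSpace C(T, 𝕜) := sigmaTopology (measureSpaceD T 𝕜)
  constructor
  · intro h
    by_contra hne
    push Not at hne
    obtain ⟨hfin, hcof⟩ := hne
    have hS : ∀ m : T, IsMax m → m ∈ countablePart T := fun m hm => by
      by_contra hmS
      have hlt := lt_of_not_ge (show ¬ cofinality m ≤ Cardinal.aleph0 from hmS)
      exact hlt.not_ge (hcof m hm (isSuccLimit_height_of_aleph0_lt hlt))
    -- Every `V_y` contains a maximal element, so this neighbourhood of 0 excludes all `g_y`; it is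
    -- open because the maximal elements are finitely many and lie in `S(T)`.
    have hU : IsOpen[τ] (⋂ m ∈ {m : T | IsMax m}, {h : C(T, 𝕜) | h m ≠ 1}) :=
      hfin.isOpen_biInter fun m hm =>
        isOpen_compl_singleton.preimage (continuous_apply_sigmaTopology (hS m hm))
    refine not_accPt_of_isOpen hU (mem_iInter₂.2 fun m _ => zero_ne_one) ?_ h
    rintro _ hy (⟨y, rfl⟩ | h0)
    · obtain ⟨m, hym, hm⟩ := exists_isMax_ge (y : T)
      exact absurd (basisFun_apply_of_le hym) (mem_iInter₂.1 hy m hm)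
    · exact h0
  · rintro (h | ⟨m, hm, -, hcof⟩)
    · exact accPt_zero_of_infinite h
    · exact accPt_zero_of_isMax hm hcof

end Accumulation

end WedgeTree

theorem propositionP (𝕜 : Type*) [RCLike 𝕜] (T : Type*) [PartialOrder T] [OrderBot T]
    [ChainCompleteTree T] [TopologicalSpace T] [CoarseWedgeTopology T]
    [MeasurableSpace T] [BorelSpace T] :
    IsStrongMarkushevichBasis (basisFun (T := T) 𝕜) (basisFunctional (T := T) 𝕜) ∧
    (IsROneTree T →
      IsClosed[sigmaTopology (measureSpaceD T 𝕜)] (basisSet T 𝕜) ∧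
      (∀ A, ∀ hA : A ∈ separableFamily T, ∀ f ∈ basisSet T 𝕜, proj A hA.1.1 f ∈ basisSet T 𝕜) ∧
      (∀ f : C(T, 𝕜), f ≠ 0 →
        (@AccPt _ (sigmaTopology (measureSpaceD T 𝕜)) f (Filter.principal (basisSet T 𝕜)) ↔
          ∃ x : isolatedPart T, (x : T) ≠ ⊥ ∧
            Cardinal.aleph0 < cofinality (predecessor (x : T)) ∧ f = basisFun 𝕜 x)) ∧
      (@AccPt _ (sigmaTopology (measureSpaceD T 𝕜)) 0 (Filter.principal (basisSet T 𝕜)) ↔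
        ({m : T | IsMax m}.Infinite ∨
          ∃ m : T, IsMax m ∧ Order.IsSuccLimit (height m) ∧
            Cardinal.aleph0 < cofinality m))) := by
  refine ⟨isStrongMarkushevichBasis_basisFun, fun hT => ⟨isClosed_basisSet hT,
    fun A hA f hf => proj_mem_basisSet hA.1 hf, fun f hf => accPt_basisSet_iff hT hf,
    accPt_zero_iff⟩⟩
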